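/- \textbf{Proposition 1.} Let $\mathcal G$ be a finite undirected graph with node set $V$, symmetric weight matrix $W$ with nonnegative entries (nodes $i\neq j$ are joined by an edge when $W_{ij}>0$), degree matrix $D=\mathrm{diag}(d)$, $d_i=\sum_j W_{ij}$, and Laplacian $L=D-W$. A rooted spanning forest $\varphi$ of $\mathcal G$ is a subgraph without cycles that contains all nodes, with exactly one distinguished node (root) in each of its connected components; $\rho(\varphi)$ is the set of roots, and $r_\varphi(i)$ is the root of the tree containing $i$. Let $y\in\mathbb R^V$. (a) Let $q>0$, let $\Phi_q$ be a random rooted spanning forest with $\mathbb P(\Phi_q=\varphi)\propto q^{|\rho(\varphi)|}\prod_{(ij)\in\varphi}W_{ij}$, and put $\tilde x(i)=y[r_{\Phi_q}(i)]$ for $i\in V$. Then $qI+L$ is invertible and, with $K=q(qI+L)^{-1}$ and $\hat x=Ky$, the estimator $\tilde x$ is unbiased, $\mathbb E[\tilde x]=\hat x$, and $$\mathbb E\big(\|\tilde x-\hat x\|^2\big)=\sum_i\mathrm{var}(\tilde x(i))=y^t(I-K^2)y .$$ (b) Let $Q=\mathrm{diag}(q_i)_{i\in V}$ with all $q_i>0$,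 let $\Phi_Q$ be a random rooted spanning forest with $\mathbb P(\Phi_Q=\varphi)\propto\prod_{r\in\rho(\varphi)}q_r\prod_{(ij)\in\varphi}W_{ij}$, and put $\tilde x(i)=y[r_{\Phi_Q}(i)]$ for $i\in V$. Then $Q+L$ is invertible and, with $K=(Q+L)^{-1}Q$ and $\hat x=Ky$, again $\mathbb E[\tilde x]=\hat x$. With $y^{(2)}=(y_i^2)_{i\in V}$ and $\mathbf 1$ the all-ones vector, $$\mathbb E\big(\|\tilde x-\hat x\|^2\big)=\sum_i\mathrm{var}(\tilde x(i))=\mathbf 1^tKy^{(2)}-y^tK^tKy ,$$ and in the norm weighted by $Q$, $$\mathbb E\Big(\sum_i q_i\,(\tilde x(i)-\hat x(i))^2\Big)=\sum_i q_i\,\mathrm{var}(\tilde x(i))=y^tQ(I-K^2)y .$$ -/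

import Mathlib

open MeasureTheory ProbabilityTheory

noncomputable section

/-- A finite undirected weighted graph on the node set `V`, given by its symmetric weighted
adjacency matrix with nonnegative entries; `W i j = 0` means that `i` and `j` are not joined. -/
structure WeightedGraph (V : Type*) where
  W : Matrix V V ℝ
  symm : ∀ i j, W i j = W j i
  nonneg : ∀ i j, 0 ≤ W i j

/-- The underlying graph: `i` and `j` are adjacent when they are distinct and `W i j > 0`.
(A diagonal entry of `W` would be a self-loop: it never belongs to a forest, and it cancels in
the Laplacian.) -/
def WeightedGraph.toSimpleGraph {V : Type*} (G : WeightedGraph V) : SimpleGraph V where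
  Adj i j := i ≠ j ∧ 0 < G.W i j
  symm := ⟨fun i j h => ⟨h.1.symm, G.symm i j ▸ h.2⟩⟩
  loopless := ⟨fun _ h => h.1 rfl⟩

/-- The weight of an (unordered) edge. -/
def WeightedGraph.edgeWeight {V : Type*} (G : WeightedGraph V) : Sym2 V → ℝ :=
  Sym2.lift ⟨fun i j => G.W i j, G.symm⟩

/-- The degree of a node. -/
def WeightedGraph.degree {V : Type*} [Fintype V] (G : WeightedGraph V) (i : V) : ℝ :=
  ∑ j, G.W i j

/-- The Laplacian `L = D - W`. -/
def WeightedGraph.laplacian {V : Type*} [Fintype V] [DecidableEq V] (G : WeightedGraph V) :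
    Matrix V V ℝ :=
  Matrix.diagonal G.degree - G.W

/-- A rooted spanning forest of a graph `H`: a subgraph on all the nodes, without cycles, with
exactly one distinguished node (the root) in each of its connected components (the trees).
The orientation of the edges of a tree towards its root is determined by the root. -/
structure RootedSpanningForest {V : Type*} (H : SimpleGraph V) where
  graph : SimpleGraph V
  roots : Finset V
  le : graph ≤ H
  acyclic : graph.IsAcyclic
  existsUnique_root : ∀ i, ∃! r, r ∈ roots ∧ graph.Reachable i r

/-- The root of the tree that contains the node `i`. -/
def RootedSpanningForest.root {V : Type*} {H : SimpleGraph V} (φ : RootedSpanningForest H)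
    (i : V) : V :=
  (φ.existsUnique_root i).choose

/-- The (finite) set of rooted spanning forests carries the discrete σ-algebra. -/
instance RootedSpanningForest.instMeasurableSpace {V : Type*} {H : SimpleGraph V} :
    MeasurableSpace (RootedSpanningForest H) := ⊤

open Classical in
/-- The product of the weights of all the edges of a forest. -/
def WeightedGraph.edgeProduct {V : Type*} [Fintype V] (G : WeightedGraph V)
    (φ : RootedSpanningForest G.toSimpleGraph) : ℝ :=
  ∏ e ∈ φ.graph.edgeFinset, G.edgeWeight e

/-- `Φ` is a random element of a discrete space, whose probability mass function is
proportional to `w`. -/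
structure HasMassProportionalTo {Ω S : Type*} [MeasurableSpace Ω] [MeasurableSpace S]
    (P : Measure Ω) (Φ : Ω → S) (w : S → ℝ) : Prop where
  measurable : Measurable Φ
  proportional : ∃ c : ℝ, ∀ φ, P.real (Φ ⁻¹' {φ}) = c * w φ

/-- `Φ` is a random spanning forest with parameter `q`: the probability of a forest is
proportional to `q ^ (number of roots)` times the product of its edge weights. -/
def WeightedGraph.IsRSF {V Ω : Type*} [Fintype V] [MeasurableSpace Ω] (G : WeightedGraph V)
    (q : ℝ) (P : Measure Ω) (Φ : Ω → RootedSpanningForest G.toSimpleGraph) : Prop :=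
  HasMassProportionalTo P Φ fun φ => q ^ φ.roots.card * G.edgeProduct φ

/-- `Φ` is a random spanning forest with node parameters `q i`: the probability of a forest is
proportional to the product of the `q r` over its roots `r` times the product of its edge
weights. -/
def WeightedGraph.IsDiagRSF {V Ω : Type*} [Fintype V] [MeasurableSpace Ω] (G : WeightedGraph V)
    (q : V → ℝ) (P : Measure Ω) (Φ : Ω → RootedSpanningForest G.toSimpleGraph) : Prop :=
  HasMassProportionalTo P Φ fun φ => (∏ r ∈ φ.roots, q r) * G.edgeProduct φ

/-- `K = q (q I + L)⁻¹`. -/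
def WeightedGraph.smoother {V : Type*} [Fintype V] [DecidableEq V] (G : WeightedGraph V)
    (q : ℝ) : Matrix V V ℝ :=
  q • (q • (1 : Matrix V V ℝ) + G.laplacian)⁻¹

/-- `K = (Q + L)⁻¹ Q` with `Q = diag q`. -/
def WeightedGraph.diagSmoother {V : Type*} [Fintype V] [DecidableEq V] (G : WeightedGraph V)
    (q : V → ℝ) : Matrix V V ℝ :=
  (Matrix.diagonal q + G.laplacian)⁻¹ * Matrix.diagonal q

/-- The exact smoothed signal `K y`, as a vector of the Euclidean space. -/
def exactSignal {V : Type*} [Fintype V] (K : Matrix V V ℝ) (y : V → ℝ) : EuclideanSpace ℝ V :=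
  WithLp.toLp 2 (K.mulVec y)

/-- The estimator that takes at node `i` the value of `y` at the root of the tree of `i`. -/
def rootEstimator {V : Type*} {H : SimpleGraph V} (y : V → ℝ) (φ : RootedSpanningForest H) :
    EuclideanSpace ℝ V :=
  WithLp.toLp 2 fun i => y (φ.root i)

end

/-! Orienting each tree towards its root turns a rooted spanning forest into an acyclic parent
function `f : V → Option V`, whose roots are the nodes sent to `none`. Weigh a pointer of `i` by `q
i` if it is `none` and by `W i k` if it is `some k`; the product over all nodes is the weight of the
forest (`parentWeight_parent`, `sum_forest`).

Let N i j be the total weight of the parent functions leading `i` to `j`, and Z the total weight.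
Exchanging the pointer of `i` with a candidate pointer is a weight-preserving involution, and it
gives (Q + L) N = Z Q (`sum_pointerWeight_exchange`, `diagonal_sub_mul_rootedWeight`). Hence N / Z =
(Q + L)⁻¹ Q = K: the root of `i` is distributed as row `i` of K (`sum_root_eq`).

So y(root of i) has mean (K y) i and second moment (K y⁽²⁾) i, and only these marginal laws enter
the sums of variances. The weighted formula uses moreover that Q K is symmetric and K 1 = 1. The
scalar case is constant Q, with the factor q cancelled from the weighted formula. -/

open Relation in
/-- Following the parent pointers `f` from `i`, one arrives at `j`, which has no parent. -/
def LeadsTo {V : Type*} (f : V → Option V) (i j : V) : Prop :=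
  ReflTransGen (fun a b => f a = some b) i j ∧ f j = none

/-- A parent function: following the pointers, one always arrives at a root. -/
def IsParentFunction {V : Type*} (f : V → Option V) : Prop :=
  ∀ i, ∃ j, LeadsTo f i j

/-- The root at which the (optional) new parent `k` of `i` arrives. -/
def LeadsFrom {V : Type*} (f : V → Option V) (i : V) : Option V → V → Prop
  | none, j => i = j
  | some v, j => LeadsTo f v j

/-- `k` is an admissible new parent of `i`: its path to the root does not meet `i`. -/
def Avoids {V : Type*} (f : V → Option V) (i : V) (k : Option V) : Prop :=
  ∀ v, k = some v → ¬ Relation.ReflTransGen (fun a b => f a = some b) v i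

/-! ### Pointer walks, and redirecting the pointer of one node. -/

section ParentFunctions

open Relation

variable {V : Type*} {f g : V → Option V} {i j k v : V}

theorem eq_of_reflTransGen_of_none (hj : f j = none)
    (h : ReflTransGen (fun a b => f a = some b) j k) : j = k := by
  rcases h.cases_head with h | ⟨c, hc, -⟩
  · exact h
  · simp [hj] at hc

/-- Walks are deterministic, so two walks from `i` are comparable, and one that ends at a root
cannot be prolonged. -/
theorem leadsTo_iff_of_reflTransGen (h : ReflTransGen (fun a b => f a = some b) i k) :
    LeadsTo f i j ↔ LeadsTo f k j := by
  refine ⟨fun hi => ⟨?_, hi.2⟩, fun hk => ⟨h.trans hk.1, hk.2⟩⟩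
  have hu : Relator.RightUnique (fun a b => f a = some b) := fun a b c hb hc => by
    simpa [hb] using hc
  rcases ReflTransGen.total_of_right_unique hu h hi.1 with h' | h'
  · exact h'
  · rw [eq_of_reflTransGen_of_none hi.2 h']

theorem LeadsTo.unique (hj : LeadsTo f i j) (hk : LeadsTo f i k) : j = k :=
  eq_of_reflTransGen_of_none hj.2 ((leadsTo_iff_of_reflTransGen hj.1).1 hk).1

/-- A cycle through a node also passes through its parent; pushed along the walk to the root, it
would give the root a parent. -/
theorem IsParentFunction.not_transGen (hf : IsParentFunction f) (i : V) :
    ¬ TransGen (fun a b => f a = some b) i i := by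
  obtain ⟨j, hij, hj⟩ := hf i
  induction hij using ReflTransGen.head_induction_on with
  | refl =>
    intro h
    obtain ⟨c, hc, -⟩ := TransGen.head'_iff.1 h
    simp [hj] at hc
  | head hac _ ih =>
    intro h
    obtain ⟨c', hc', h'⟩ := TransGen.head'_iff.1 h
    obtain rfl := Option.some.inj (hac.symm.trans hc')
    exact ih (TransGen.tail' h' hac)

theorem IsParentFunction.avoids (hf : IsParentFunction f) (i : V) : Avoids f i (f i) :=
  fun _ hv h => hf.not_transGen i (TransGen.head' hv h)

/-- A walk that never meets `i` does not see the pointer of `i`. -/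
theorem reflTransGen_of_agree (hfg : ∀ a, a ≠ i → f a = g a)
    (hv : ¬ ReflTransGen (fun a b => f a = some b) v i)
    (h : ReflTransGen (fun a b => f a = some b) v k) :
    ReflTransGen (fun a b => g a = some b) v k := by
  induction h using ReflTransGen.head_induction_on with
  | refl => exact .refl
  | @head a c hac _ ih =>
    have hai : a ≠ i := by rintro rfl; exact hv .refl
    exact .head ((hfg a hai).symm.trans hac) (ih fun h => hv (.head hac h))

theorem not_reflTransGen_of_agree (hfg : ∀ a, a ≠ i → f a = g a)
    (hv : ¬ ReflTransGen (fun a b => f a = some b) v i) :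
    ¬ ReflTransGen (fun a b => g a = some b) v i := by
  intro h
  induction h using ReflTransGen.head_induction_on with
  | refl => exact hv .refl
  | @head a c hac _ ih =>
    have hai : a ≠ i := by rintro rfl; exact hv .refl
    exact ih fun h => hv (.head ((hfg a hai).trans hac) h)

theorem LeadsTo.of_agree (hfg : ∀ a, a ≠ i → f a = g a)
    (hv : ¬ ReflTransGen (fun a b => f a = some b) v i) (h : LeadsTo f v j) : LeadsTo g v j := by
  refine ⟨reflTransGen_of_agree hfg hv h.1, ?_⟩
  rw [← hfg j (by rintro rfl; exact hv h.1), h.2]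

/-- Up to its first visit to `i`, a walk uses only pointers of other nodes. -/
theorem reflTransGen_self_of_agree (hfg : ∀ a, a ≠ i → f a = g a)
    (h : ReflTransGen (fun a b => f a = some b) v i) :
    ReflTransGen (fun a b => g a = some b) v i := by
  induction h using ReflTransGen.head_induction_on with
  | refl => exact .refl
  | @head a c hac _ ih =>
    by_cases hai : a = i
    · rw [hai]
    · exact .head ((hfg a hai).symm.trans hac) ih

variable {o : Option V}

theorem IsParentFunction.exists_leadsFrom (hf : IsParentFunction f) (i : V) (o : Option V) :
    ∃ j, LeadsFrom f i o j := by
  rcases o with _ | v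
  · exact ⟨i, rfl⟩
  · exact hf v

theorem leadsFrom_iff_of_not_avoids (h : ¬ Avoids f i o) : LeadsFrom f i o j ↔ LeadsTo f i j := by
  rcases o with _ | v
  · exact absurd (fun _ hv => by simp at hv) h
  · simp only [Avoids, Option.some.injEq, forall_eq', not_not] at h
    exact leadsTo_iff_of_reflTransGen h

variable [DecidableEq V]

theorem agree_update (f : V → Option V) (i : V) (o : Option V) :
    ∀ a, a ≠ i → f a = Function.update f i o a :=
  fun _ ha => (Function.update_of_ne ha _ _).symm

theorem Avoids.update (p : Option V) (h : Avoids f i o) : Avoids (Function.update f i p) i o :=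
  fun v hv => not_reflTransGen_of_agree (agree_update f i p) (h v hv)

theorem Avoids.leadsTo_update (h : Avoids f i o) (hj : LeadsFrom f i o j) :
    LeadsTo (Function.update f i o) i j := by
  rcases o with _ | v
  · obtain rfl : i = j := hj
    exact ⟨.refl, by simp⟩
  · have := LeadsTo.of_agree (agree_update f i (some v)) (h v rfl) hj
    exact ⟨.head (by simp) this.1, this.2⟩

/-- Nodes whose walk meets `i` continue from there through `o`; the walks of all other nodes are
unchanged. -/
theorem IsParentFunction.update (hf : IsParentFunction f) (h : Avoids f i o) :
    IsParentFunction (Function.update f i o) := by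
  intro v
  by_cases hv : ReflTransGen (fun a b => f a = some b) v i
  · obtain ⟨j, hj⟩ := hf.exists_leadsFrom i o
    exact ⟨j, (leadsTo_iff_of_reflTransGen
      (reflTransGen_self_of_agree (agree_update f i o) hv)).2 (h.leadsTo_update hj)⟩
  · obtain ⟨j, hj⟩ := hf v
    exact ⟨j, hj.of_agree (agree_update f i o) hv⟩

theorem IsParentFunction.leadsTo_update_iff (hf : IsParentFunction f) (h : Avoids f i o) :
    LeadsTo (Function.update f i o) i j ↔ LeadsFrom f i o j := by
  refine ⟨fun hj => ?_, h.leadsTo_update⟩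
  obtain ⟨k, hk⟩ := hf.exists_leadsFrom i o
  rwa [hj.unique (h.leadsTo_update hk)]

end ParentFunctions

/-! ### The matrix forest theorem by exchange of pointers. -/

section Weights

open Classical in
/-- The parent functions on a finite set. -/
noncomputable def parentFunctions (V : Type*) [Fintype V] : Finset (V → Option V) :=
  Finset.univ.filter IsParentFunction

/-- The weight of a pointer: `q i` for a root, `W i k` for a pointer to `k`. -/
def pointerWeight {V : Type*} (q : V → ℝ) (W : Matrix V V ℝ) (i : V) : Option V → ℝ
  | none => q i
  | some k => W i k

/-- The product of the weights of the pointers. -/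
noncomputable def parentWeight {V : Type*} [Fintype V] (q : V → ℝ) (W : Matrix V V ℝ)
    (f : V → Option V) : ℝ :=
  ∏ i, pointerWeight q W i (f i)

open Classical in
/-- The total weight of the parent functions that lead `i` to `j`. -/
noncomputable def rootedWeight {V : Type*} [Fintype V] (q : V → ℝ) (W : Matrix V V ℝ) :
    Matrix V V ℝ :=
  Matrix.of fun i j => ∑ f ∈ parentFunctions V, if LeadsTo f i j then parentWeight q W f else 0

variable {V : Type*} [Fintype V] [DecidableEq V] (q : V → ℝ) (W : Matrix V V ℝ)

/-- The product form avoids dividing by the old pointer weight, which may vanish. -/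
theorem mul_parentWeight_update (f : V → Option V) (i : V) (o : Option V) :
    pointerWeight q W i (f i) * parentWeight q W (Function.update f i o) =
      pointerWeight q W i o * parentWeight q W f := by
  unfold parentWeight
  rw [← Finset.mul_prod_erase _ _ (Finset.mem_univ i),
    ← Finset.mul_prod_erase _ (fun v => pointerWeight q W v (f v)) (Finset.mem_univ i)]
  have : ∏ v ∈ Finset.univ.erase i, pointerWeight q W v (Function.update f i o v) =
      ∏ v ∈ Finset.univ.erase i, pointerWeight q W v (f v) :=
    Finset.prod_congr rfl fun v hv => by
      rw [Function.update_of_ne (Finset.ne_of_mem_erase hv)]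
  rw [this, Function.update_self]
  ring

-- This is entry `(i, j)` of (Q + D) N = W N + Z Q, with `o = none` producing the terms in Q. If `o`
-- avoids `i`, the involution `(f, o) ↦ (update f i o, f i)` carries one side to the other.
-- Otherwise `o` is a node whose walk meets `i`, so it has the same root as `i` and the terms agree
-- one by one.
open Classical in
theorem sum_pointerWeight_exchange (i j : V) :
    (∑ f ∈ parentFunctions V, ∑ o : Option V,
      if LeadsTo f i j then pointerWeight q W i o * parentWeight q W f else 0) =
    ∑ f ∈ parentFunctions V, ∑ o : Option V,
      if LeadsFrom f i o j then pointerWeight q W i o * parentWeight q W f else 0 := by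
  rw [← Finset.sum_product', ← Finset.sum_product',
    ← Finset.sum_filter_add_sum_filter_not _ (fun p => Avoids p.1 i p.2),
    ← Finset.sum_filter_add_sum_filter_not (parentFunctions V ×ˢ Finset.univ)
      (fun p => Avoids p.1 i p.2)
      (fun p => if LeadsFrom p.1 i p.2 j then _ else _)]
  congr 1
  · have key : ∀ p ∈ (parentFunctions V ×ˢ (Finset.univ : Finset (Option V))).filter
        (fun p => Avoids p.1 i p.2), (Function.update p.1 i p.2, p.1 i) ∈
        (parentFunctions V ×ˢ (Finset.univ : Finset (Option V))).filter
        (fun p => Avoids p.1 i p.2) := by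
      rintro ⟨f, o⟩ h
      simp only [parentFunctions, Finset.mem_filter, Finset.mem_product, Finset.mem_univ,
        true_and, and_true] at h ⊢
      exact ⟨h.1.update h.2, (h.1.avoids i).update o⟩
    symm
    refine Finset.sum_nbij' (fun p => (Function.update p.1 i p.2, p.1 i))
      (fun p => (Function.update p.1 i p.2, p.1 i)) key key (by simp) (by simp) ?_
    rintro ⟨f, o⟩ h
    simp only [parentFunctions, Finset.mem_filter, Finset.mem_product, Finset.mem_univ,
        true_and, and_true] at h
    simp only [h.1.leadsTo_update_iff h.2, mul_parentWeight_update]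
  · refine Finset.sum_congr rfl ?_
    rintro ⟨f, o⟩ h
    simp only [Finset.mem_filter] at h
    simp only [leadsFrom_iff_of_not_avoids h.2]

/-- The weighted matrix forest theorem: `(Q + D - W) N = Z Q`. -/
theorem diagonal_sub_mul_rootedWeight :
    (Matrix.diagonal q + (Matrix.diagonal (fun i => ∑ j, W i j) - W)) * rootedWeight q W =
      (∑ f ∈ parentFunctions V, parentWeight q W f) • Matrix.diagonal q := by
  classical
  ext i j
  have h := sum_pointerWeight_exchange q W i j
  have hW : ∑ x, W i x * rootedWeight q W x j = ∑ f ∈ parentFunctions V, ∑ x,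
      if LeadsTo f x j then W i x * parentWeight q W f else 0 := by
    rw [Finset.sum_comm]
    simp only [rootedWeight, Matrix.of_apply, Finset.mul_sum, mul_ite_zero]
  have hN (a : ℝ) : a * rootedWeight q W i j = ∑ f ∈ parentFunctions V,
      if LeadsTo f i j then a * parentWeight q W f else 0 := by
    simp only [rootedWeight, Matrix.of_apply, Finset.mul_sum, mul_ite_zero]
  have hd : (∑ x, W i x) * rootedWeight q W i j = ∑ f ∈ parentFunctions V, ∑ x,
      if LeadsTo f i j then W i x * parentWeight q W f else 0 := by
    rw [Finset.sum_comm, Finset.sum_mul]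
    simp only [hN]
  have hZ : (∑ f ∈ parentFunctions V, parentWeight q W f) * (if i = j then q i else 0) =
      ∑ f ∈ parentFunctions V, if i = j then q i * parentWeight q W f else 0 := by
    split_ifs <;> simp [Finset.mul_sum, mul_comm]
  have hnone : (∑ f ∈ parentFunctions V,
      if LeadsFrom f i none j then q i * parentWeight q W f else 0) =
      ∑ f ∈ parentFunctions V, if i = j then q i * parentWeight q W f else 0 :=
    Finset.sum_congr rfl fun f _ => by
      by_cases hij : i = j
      · rw [if_pos hij, if_pos (show LeadsFrom f i none j from hij)]
      · rw [if_neg hij, if_neg (show ¬ LeadsFrom f i none j from hij)]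
  have hsome : (∑ f ∈ parentFunctions V, ∑ x,
      if LeadsFrom f i (some x) j then W i x * parentWeight q W f else 0) =
      ∑ f ∈ parentFunctions V, ∑ x,
        if LeadsTo f x j then W i x * parentWeight q W f else 0 := rfl
  simp only [Fintype.sum_option, pointerWeight, Finset.sum_add_distrib] at h
  rw [hnone, hsome] at h
  simp only [Matrix.add_mul, Matrix.sub_mul, Matrix.add_apply, Matrix.sub_apply,
    Matrix.diagonal_mul, Matrix.smul_apply, smul_eq_mul, Matrix.mul_apply (M := W),
    Matrix.diagonal_apply]
  rw [hN, hd, hW, hZ]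
  linarith

end Weights

/-! ### Rooted spanning forests as parent functions. -/

section Bijection

open Relation

variable {V : Type*} {H : SimpleGraph V}

/-- The undirected graph of the pointers of `f`. -/
def parentGraph (f : V → Option V) : SimpleGraph V :=
  SimpleGraph.fromRel fun a b => f a = some b

theorem parentGraph_adj {f : V → Option V} (hf : IsParentFunction f) {a b : V} :
    (parentGraph f).Adj a b ↔ f a = some b ∨ f b = some a := by
  refine ⟨fun h => h.2, fun h => ⟨?_, h⟩⟩
  rintro rfl
  exact hf.not_transGen a (.single (h.elim id id))

theorem reachable_parentGraph {f : V → Option V} (hf : IsParentFunction f) {i j : V}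
    (h : ReflTransGen (fun a b => f a = some b) i j) : (parentGraph f).Reachable i j := by
  induction h with
  | refl => rfl
  | tail _ h ih => exact ih.trans ((parentGraph_adj hf).2 (.inl h)).reachable

/-- Once the edge is deleted, whatever is still connected to `v` walks down to `v`: an edge either
prolongs such a walk backwards or follows it one step forwards. Were `w` among these nodes, `v → w`
would close a cycle. -/
theorem isBridge_parentGraph {f : V → Option V} (hf : IsParentFunction f) {v w : V}
    (h : f v = some w) : (parentGraph f).IsBridge s(v, w) := by
  rw [SimpleGraph.isBridge_iff]
  intro hr
  have key : ∀ x, ((parentGraph f).deleteEdges {s(v, w)}).Reachable v x →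
      ReflTransGen (fun a b => f a = some b) x v := by
    intro x hx
    rw [SimpleGraph.reachable_iff_reflTransGen] at hx
    induction hx with
    | refl => exact .refl
    | @tail x y _ hxy ih =>
      rw [SimpleGraph.deleteEdges_adj, parentGraph_adj hf] at hxy
      obtain ⟨hxy | hxy, hne⟩ := hxy
      · rcases ih.cases_head with rfl | ⟨c, hc, hcv⟩
        · obtain rfl := Option.some.inj (h.symm.trans hxy)
          simp at hne
        · obtain rfl := Option.some.inj (hc.symm.trans hxy)
          exact hcv
      · exact .head hxy ih
  exact hf.not_transGen v (.head' h (key w hr))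

theorem isAcyclic_parentGraph {f : V → Option V} (hf : IsParentFunction f) :
    (parentGraph f).IsAcyclic := by
  rw [SimpleGraph.isAcyclic_iff_forall_adj_isBridge]
  intro v w h
  rcases (parentGraph_adj hf).1 h with h | h
  · exact isBridge_parentGraph hf h
  · rw [Sym2.eq_swap]
    exact isBridge_parentGraph hf h

theorem leadsTo_iff_of_adj {f : V → Option V} (hf : IsParentFunction f) {a b j : V}
    (h : (parentGraph f).Adj a b) : LeadsTo f a j ↔ LeadsTo f b j := by
  rcases (parentGraph_adj hf).1 h with h | h
  · exact leadsTo_iff_of_reflTransGen (.single h)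
  · exact (leadsTo_iff_of_reflTransGen (.single h)).symm

theorem leadsTo_iff_of_reachable {f : V → Option V} (hf : IsParentFunction f) {a b j : V}
    (h : (parentGraph f).Reachable a b) : LeadsTo f a j ↔ LeadsTo f b j := by
  rw [SimpleGraph.reachable_iff_reflTransGen] at h
  induction h with
  | refl => rfl
  | tail _ h ih => exact ih.trans (leadsTo_iff_of_adj hf h)

open Classical in
/-- The rooted spanning forest of a parent function whose pointers are edges of `H`. -/
noncomputable def IsParentFunction.forest [Fintype V] {f : V → Option V}
    (hf : IsParentFunction f) (hH : ∀ i k, f i = some k → H.Adj i k) :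
    RootedSpanningForest H where
  graph := parentGraph f
  roots := Finset.univ.filter fun i => f i = none
  le a b h := by
    rcases (parentGraph_adj hf).1 h with h | h
    · exact hH _ _ h
    · exact (hH _ _ h).symm
  acyclic := isAcyclic_parentGraph hf
  existsUnique_root i := by
    obtain ⟨j, hj⟩ := hf i
    refine ⟨j, ⟨by simpa using hj.2, reachable_parentGraph hf hj.1⟩, ?_⟩
    rintro r ⟨hr, hir⟩
    have hr' : f r = none := by simpa using hr
    exact LeadsTo.unique ((leadsTo_iff_of_reachable hf hir).2 ⟨.refl, hr'⟩) hj

/-- A parent function is determined by its graph and its roots. -/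
theorem IsParentFunction.eq_of_parentGraph_eq {f g : V → Option V} (hf : IsParentFunction f)
    (hg : IsParentFunction g) (hroots : ∀ i, f i = none ↔ g i = none)
    (hgraph : parentGraph f = parentGraph g) : f = g := by
  funext i
  obtain ⟨j, hij, hj⟩ := hf i
  induction hij using ReflTransGen.head_induction_on with
  | refl => rw [hj, (hroots j).1 hj]
  | @head a c hac _ ih =>
    have h : (parentGraph g).Adj a c := hgraph ▸ (parentGraph_adj hf).2 (.inl hac)
    rcases (parentGraph_adj hg).1 h with h | h
    · rw [hac, h]
    -- If `g` reversed this edge, then `f c = g c = some a` would form a 2-cycle with `f a = some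
    -- c`.
    · exact (hf.not_transGen a (.head hac (.single (ih.trans h)))).elim

namespace RootedSpanningForest

variable (φ : RootedSpanningForest H)

theorem root_mem (i : V) : φ.root i ∈ φ.roots := (φ.existsUnique_root i).choose_spec.1.1

theorem reachable_root (i : V) : φ.graph.Reachable i (φ.root i) :=
  (φ.existsUnique_root i).choose_spec.1.2

theorem eq_root {i r : V} (hr : r ∈ φ.roots) (h : φ.graph.Reachable i r) : r = φ.root i :=
  (φ.existsUnique_root i).choose_spec.2 r ⟨hr, h⟩

theorem root_eq_of_reachable {i k : V} (h : φ.graph.Reachable i k) : φ.root i = φ.root k :=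
  φ.eq_root (φ.root_mem i) (h.symm.trans (φ.reachable_root i))

/-- The next node on a geodesic to the root serves as the parent; the decreasing distance makes the
walks terminate. -/
theorem exists_adj_dist_lt {i : V} (hi : i ∉ φ.roots) :
    ∃ k, φ.graph.Adj i k ∧ φ.graph.dist k (φ.root k) < φ.graph.dist i (φ.root i) := by
  obtain ⟨p, hp⟩ := (φ.reachable_root i).exists_walk_length_eq_dist
  have hne : i ≠ φ.root i := fun h => hi (h ▸ φ.root_mem i)
  generalize hr : φ.root i = r at p hp hne
  cases p with
  | nil => exact (hne rfl).elim
  | @cons _ k _ h p =>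
    refine ⟨k, h, ?_⟩
    rw [← φ.root_eq_of_reachable h.reachable, hr, ← hp, SimpleGraph.Walk.length_cons]
    exact Nat.lt_succ_of_le (SimpleGraph.dist_le p)

theorem exists_parentFunction : ∃ f : V → Option V, IsParentFunction f ∧
    (∀ i, f i = none ↔ i ∈ φ.roots) ∧ parentGraph f = φ.graph := by
  classical
  choose! p hadj hlt using fun i (hi : i ∉ φ.roots) => φ.exists_adj_dist_lt hi
  let f : V → Option V := fun i => if i ∈ φ.roots then none else some (p i)
  have hnone : ∀ i, f i = none ↔ i ∈ φ.roots := fun i => by simp [f]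
  have hsome : ∀ {i k}, f i = some k → i ∉ φ.roots ∧ p i = k := fun {i k} h => by
    by_cases hi : i ∈ φ.roots <;> simp_all [f]
  have hf : IsParentFunction f := by
    intro i
    induction hn : φ.graph.dist i (φ.root i) using Nat.strong_induction_on generalizing i with
    | _ n ih =>
      subst hn
      by_cases hi : i ∈ φ.roots
      · exact ⟨i, .refl, (hnone i).2 hi⟩
      · obtain ⟨j, hj⟩ := ih _ (hlt i hi) (p i) rfl
        exact ⟨j, .head (by simp [f, hi]) hj.1, hj.2⟩
  have hle : parentGraph f ≤ φ.graph := by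
    intro a b h
    rcases (parentGraph_adj hf).1 h with h | h
    · obtain ⟨ha, rfl⟩ := hsome h
      exact hadj a ha
    · obtain ⟨hb, rfl⟩ := hsome h
      exact (hadj b hb).symm
  refine ⟨f, hf, hnone, le_antisymm hle fun a b h => ?_⟩
  -- The ends of an edge missing from `parentGraph f` are already joined there through their common
  -- root, so the edge would not be a bridge of the acyclic `φ.graph`.
  by_contra hab
  have hroot : ∀ i, (parentGraph f).Reachable i (φ.root i) := fun i => by
    obtain ⟨j, hij, hj⟩ := hf i
    have hr := reachable_parentGraph hf hij
    rwa [← φ.eq_root ((hnone j).1 hj) (hr.mono hle)]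
  have hreach : (parentGraph f).Reachable a b :=
    (hroot a).trans (φ.root_eq_of_reachable h.reachable ▸ (hroot b).symm)
  refine SimpleGraph.isBridge_iff.1
    (SimpleGraph.isAcyclic_iff_forall_adj_isBridge.1 φ.acyclic h) (hreach.mono ?_)
  intro x y hxy
  rw [SimpleGraph.deleteEdges_adj]
  refine ⟨hle hxy, fun he => hab ?_⟩
  rw [← SimpleGraph.mem_edgeSet, ← Set.mem_singleton_iff.1 he]
  exact hxy

/-- The parent function of a rooted spanning forest. -/
noncomputable def parent : V → Option V := φ.exists_parentFunction.choose

theorem isParentFunction_parent : IsParentFunction φ.parent :=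
  φ.exists_parentFunction.choose_spec.1

theorem parent_eq_none {i : V} : φ.parent i = none ↔ i ∈ φ.roots :=
  φ.exists_parentFunction.choose_spec.2.1 i

theorem parentGraph_parent : parentGraph φ.parent = φ.graph :=
  φ.exists_parentFunction.choose_spec.2.2

theorem leadsTo_parent_iff {i j : V} : LeadsTo φ.parent i j ↔ φ.root i = j := by
  have key : ∀ {j}, LeadsTo φ.parent i j → φ.root i = j := fun h =>
    (φ.eq_root (φ.parent_eq_none.1 h.2) (φ.parentGraph_parent ▸
      reachable_parentGraph φ.isParentFunction_parent h.1)).symm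
  refine ⟨key, ?_⟩
  rintro rfl
  obtain ⟨k, hk⟩ := φ.isParentFunction_parent i
  rwa [key hk]

@[ext]
theorem ext {φ ψ : RootedSpanningForest H} (hg : φ.graph = ψ.graph) (hr : φ.roots = ψ.roots) :
    φ = ψ := by
  cases φ; cases ψ; cases hg; cases hr; rfl

theorem parent_injective :
    Function.Injective (parent : RootedSpanningForest H → V → Option V) := by
  intro φ ψ h
  ext1
  · rw [← φ.parentGraph_parent, ← ψ.parentGraph_parent, h]
  · ext i
    rw [← φ.parent_eq_none, ← ψ.parent_eq_none, h]

theorem parent_forest [Fintype V] {f : V → Option V} (hf : IsParentFunction f)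
    (hH : ∀ i k, f i = some k → H.Adj i k) : (hf.forest hH).parent = f :=
  (isParentFunction_parent _).eq_of_parentGraph_eq hf
    (fun i => by rw [parent_eq_none]; simp [IsParentFunction.forest])
    (parentGraph_parent _)

noncomputable instance [Finite V] : Fintype (RootedSpanningForest H) :=
  have := Finite.of_injective _ (parent_injective (H := H))
  Fintype.ofFinite _

end RootedSpanningForest

/-! ### Forest weights as products of pointer weights. -/

namespace WeightedGraph

variable [Fintype V] (G : WeightedGraph V) (q : V → ℝ)

theorem edgeProduct_eq (φ : RootedSpanningForest G.toSimpleGraph) :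
    G.edgeProduct φ =
      ∏ i with φ.parent i ≠ none, pointerWeight q G.W i (φ.parent i) := by
  classical
  have hp := φ.isParentFunction_parent
  have hadj : ∀ {a b}, φ.graph.Adj a b ↔ φ.parent a = some b ∨ φ.parent b = some a :=
    fun {a b} => by rw [← parentGraph_adj hp, φ.parentGraph_parent]
  symm
  -- Each edge is the pointer of exactly one of its ends, as two would form a 2-cycle. The default
  -- of `getD` is never reached, since `i` is not a root.
  refine Finset.prod_bij (fun i _ => s(i, (φ.parent i).getD i)) ?_ ?_ ?_ ?_
  · intro i hi
    obtain ⟨k, hk⟩ := Option.ne_none_iff_exists'.1 (Finset.mem_filter.1 hi).2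
    simp [hk, hadj]
  · intro i hi j hj hij
    obtain ⟨k, hk⟩ := Option.ne_none_iff_exists'.1 (Finset.mem_filter.1 hi).2
    obtain ⟨l, hl⟩ := Option.ne_none_iff_exists'.1 (Finset.mem_filter.1 hj).2
    simp only [hk, hl, Option.getD_some, Sym2.eq_iff] at hij
    rcases hij with ⟨h, -⟩ | ⟨rfl, rfl⟩
    · exact h
    · exact (hp.not_transGen i (.head hk (.single hl))).elim
  · intro e he
    induction e using Sym2.ind with
    | _ a b =>
      rw [SimpleGraph.mem_edgeFinset, SimpleGraph.mem_edgeSet, hadj] at he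
      rcases he with h | h
      · exact ⟨a, by simp [h], by simp [h]⟩
      · exact ⟨b, by simp [h], by simp [h, Sym2.eq_swap]⟩
  · intro i hi
    obtain ⟨k, hk⟩ := Option.ne_none_iff_exists'.1 (Finset.mem_filter.1 hi).2
    simp [hk, pointerWeight, edgeWeight]

theorem parentWeight_parent (φ : RootedSpanningForest G.toSimpleGraph) :
    parentWeight q G.W φ.parent = (∏ r ∈ φ.roots, q r) * G.edgeProduct φ := by
  rw [parentWeight, ← Finset.prod_filter_mul_prod_filter_not _ (fun i => φ.parent i = none),
    G.edgeProduct_eq q]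
  congr 1
  have : (Finset.univ.filter fun i => φ.parent i = none) = φ.roots := by
    ext i
    simp [φ.parent_eq_none]
  rw [this]
  exact Finset.prod_congr rfl fun i hi => by rw [φ.parent_eq_none.2 hi, pointerWeight]

/-- A parent function that comes from no forest of `G` has a pointer along a non-edge, hence weight
zero. -/
theorem sum_forest (A : (V → Option V) → ℝ) :
    ∑ φ : RootedSpanningForest G.toSimpleGraph,
        A φ.parent * ((∏ r ∈ φ.roots, q r) * G.edgeProduct φ) =
      ∑ f ∈ parentFunctions V, A f * parentWeight q G.W f := by
  refine Finset.sum_of_injOn RootedSpanningForest.parent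
    (RootedSpanningForest.parent_injective.injOn) ?_ ?_ ?_
  · intro φ _
    simpa [parentFunctions] using φ.isParentFunction_parent
  · intro f hf hne
    have hf' : IsParentFunction f := by simpa [parentFunctions] using hf
    by_contra h
    refine hne ⟨hf'.forest fun i k hik => ?_, by simp, RootedSpanningForest.parent_forest _ _⟩
    have hik' : i ≠ k := by
      rintro rfl
      exact hf'.not_transGen i (.single hik)
    refine ⟨hik', (G.nonneg i k).lt_of_ne fun h0 => h ?_⟩
    rw [parentWeight, Finset.prod_eq_zero (Finset.mem_univ i), mul_zero]
    rw [hik, pointerWeight, ← h0]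
  · intro φ _
    rw [G.parentWeight_parent q]

end WeightedGraph

end Bijection

/-! ### Integration over the finite space of forests. -/

namespace RootedSpanningForest

variable {V : Type*} [Fintype V] {H : SimpleGraph V}

instance : MeasurableSingletonClass (RootedSpanningForest H) := ⟨fun _ => trivial⟩

variable {Ω E : Type*} [MeasurableSpace Ω] {P : Measure Ω} [IsProbabilityMeasure P]
  {Φ : Ω → RootedSpanningForest H} [NormedAddCommGroup E]

theorem memLp_comp (hΦ : Measurable Φ) (g : RootedSpanningForest H → E) (p : ENNReal) :
    MemLp (fun ω => g (Φ ω)) p P := by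
  have := Measure.isProbabilityMeasure_map (μ := P) hΦ.aemeasurable
  exact (memLp_map_measure_iff (StronglyMeasurable.of_discrete).aestronglyMeasurable
    hΦ.aemeasurable).1 (MemLp.of_discrete (f := g) (μ := P.map Φ))

theorem integral_comp [NormedSpace ℝ E] [CompleteSpace E] (hΦ : Measurable Φ) (g : RootedSpanningForest H → E) :
    ∫ ω, g (Φ ω) ∂P = ∑ φ, P.real (Φ ⁻¹' {φ}) • g φ := by
  have := Measure.isProbabilityMeasure_map (μ := P) hΦ.aemeasurable
  rw [← integral_map hΦ.aemeasurable (StronglyMeasurable.of_discrete).aestronglyMeasurable,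
    integral_fintype Integrable.of_finite]
  simp only [map_measureReal_apply hΦ (measurableSet_singleton _)]

end RootedSpanningForest

/-! ### The smoother, and the moments of the estimator. -/

namespace WeightedGraph

theorem IsRSF.isDiagRSF {V Ω : Type*} [Fintype V] [MeasurableSpace Ω] {G : WeightedGraph V}
    {P : Measure Ω} {Φ : Ω → RootedSpanningForest G.toSimpleGraph} {q : ℝ} (h : G.IsRSF q P Φ) :
    G.IsDiagRSF (fun _ => q) P Φ :=
  ⟨h.measurable, by simpa only [Finset.prod_const] using h.proportional⟩

variable {V : Type*} [Fintype V] [DecidableEq V] (G : WeightedGraph V) {q : V → ℝ}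

/-- Strict diagonal dominance: self-loops cancel, and row `i` has margin `q i`. -/
theorem isUnit_diagonal_add_laplacian (hq : ∀ i, 0 < q i) :
    IsUnit (Matrix.diagonal q + G.laplacian) := by
  rw [Matrix.isUnit_iff_isUnit_det, isUnit_iff_ne_zero]
  refine det_ne_zero_of_sum_row_lt_diag fun i => ?_
  have h1 : ∑ j ∈ Finset.univ.erase i, ‖(Matrix.diagonal q + G.laplacian) i j‖ =
      ∑ j ∈ Finset.univ.erase i, G.W i j := by
    refine Finset.sum_congr rfl fun j hj => ?_
    have hij := (Finset.ne_of_mem_erase hj).symm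
    simp [laplacian, Matrix.diagonal_apply_ne _ hij, abs_of_nonneg (G.nonneg i j)]
  have h2 : G.degree i = G.W i i + ∑ j ∈ Finset.univ.erase i, G.W i j :=
    (Finset.add_sum_erase _ _ (Finset.mem_univ i)).symm
  have h3 : (Matrix.diagonal q + G.laplacian) i i =
      q i + ∑ j ∈ Finset.univ.erase i, G.W i j := by
    simp [laplacian, h2]
  have h0 : 0 ≤ ∑ j ∈ Finset.univ.erase i, G.W i j := Finset.sum_nonneg fun j _ => G.nonneg i j
  rw [h1, h3, Real.norm_of_nonneg (by linarith [hq i])]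
  linarith [hq i]

theorem transpose_laplacian : G.laplacian.transpose = G.laplacian := by
  rw [laplacian, Matrix.transpose_sub, Matrix.diagonal_transpose]
  congr 1
  ext i j
  exact G.symm j i

/-- Q K = Q (Q + L)⁻¹ Q with L symmetric, whereas K alone need not be symmetric. -/
theorem transpose_diagonal_mul_diagSmoother (q : V → ℝ) :
    (Matrix.diagonal q * G.diagSmoother q).transpose = Matrix.diagonal q * G.diagSmoother q := by
  simp only [diagSmoother, Matrix.transpose_mul, Matrix.transpose_nonsing_inv,
    Matrix.transpose_add, Matrix.diagonal_transpose, transpose_laplacian, Matrix.mul_assoc]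

theorem diagSmoother_const (q : ℝ) : G.diagSmoother (fun _ => q) = G.smoother q := by
  rw [diagSmoother, smoother, ← Matrix.smul_one_eq_diagonal, Matrix.mul_smul, mul_one]

variable {Ω : Type*} [MeasurableSpace Ω] {P : Measure Ω} [IsProbabilityMeasure P]
  {Φ : Ω → RootedSpanningForest G.toSimpleGraph}

variable {G}

namespace IsDiagRSF

/-- The root of the tree of `i` is distributed according to the row `i` of the smoother. -/
theorem sum_root_eq (hq : ∀ i, 0 < q i) (h : G.IsDiagRSF q P Φ) (i j : V) :
    (∑ φ, P.real (Φ ⁻¹' {φ}) * if φ.root i = j then 1 else 0) = G.diagSmoother q i j := by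
  classical
  obtain ⟨c, hc⟩ := h.proportional
  have hone : ∑ φ, P.real (Φ ⁻¹' {φ}) = 1 := by
    simpa using (RootedSpanningForest.integral_comp (P := P) h.measurable
      (fun _ => (1 : ℝ))).symm
  -- The unknown proportionality constant is 1 / Z, because the probabilities sum to one.
  have hZ : c * ∑ f ∈ parentFunctions V, parentWeight q G.W f = 1 := by
    rw [← hone]
    simpa [hc, Finset.mul_sum] using congrArg (c * ·) (G.sum_forest q fun _ => 1).symm
  have hN : c • rootedWeight q G.W = G.diagSmoother q := by
    have hdet := (Matrix.isUnit_iff_isUnit_det _).1 (G.isUnit_diagonal_add_laplacian hq)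
    have hmul : (Matrix.diagonal q + G.laplacian) * (c • rootedWeight q G.W) =
        Matrix.diagonal q := by
      rw [Matrix.mul_smul]
      have := diagonal_sub_mul_rootedWeight q G.W
      rw [show Matrix.diagonal q + G.laplacian = Matrix.diagonal q +
        (Matrix.diagonal (fun i => ∑ j, G.W i j) - G.W) from rfl, this, smul_smul, hZ, one_smul]
    rw [← Matrix.nonsing_inv_mul_cancel_left _ (c • rootedWeight q G.W) hdet, hmul, diagSmoother]
  rw [← hN, Matrix.smul_apply, rootedWeight, Matrix.of_apply, smul_eq_mul]
  have := congrArg (c * ·) (G.sum_forest q fun f => if LeadsTo f i j then 1 else 0)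
  simp only [RootedSpanningForest.leadsTo_parent_iff, Finset.mul_sum, ite_mul, one_mul,
    zero_mul] at this
  rw [Finset.mul_sum, ← this]
  refine Finset.sum_congr rfl fun φ _ => ?_
  rw [hc]
  split_ifs <;> simp

theorem sum_mul_root (hq : ∀ i, 0 < q i) (h : G.IsDiagRSF q P Φ) (y : V → ℝ) (i : V) :
    ∑ φ, P.real (Φ ⁻¹' {φ}) * y (φ.root i) = (G.diagSmoother q).mulVec y i := by
  simp only [Matrix.mulVec, dotProduct, ← h.sum_root_eq hq, Finset.sum_mul]
  rw [Finset.sum_comm]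
  refine Finset.sum_congr rfl fun φ _ => ?_
  simp

theorem mulVec_one (hq : ∀ i, 0 < q i) (h : G.IsDiagRSF q P Φ) :
    (G.diagSmoother q).mulVec 1 = 1 := by
  ext i
  rw [← h.sum_mul_root hq]
  simpa using (RootedSpanningForest.integral_comp (P := P) h.measurable
      (fun _ => (1 : ℝ))).symm

theorem integral_root (hq : ∀ i, 0 < q i) (h : G.IsDiagRSF q P Φ) (y : V → ℝ) (i : V) :
    ∫ ω, y ((Φ ω).root i) ∂P = (G.diagSmoother q).mulVec y i := by
  rw [RootedSpanningForest.integral_comp h.measurable fun φ => y (φ.root i)]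
  exact h.sum_mul_root hq y i

theorem integral_rootEstimator (hq : ∀ i, 0 < q i) (h : G.IsDiagRSF q P Φ) (y : V → ℝ) :
    ∫ ω, rootEstimator y (Φ ω) ∂P = exactSignal (G.diagSmoother q) y := by
  rw [RootedSpanningForest.integral_comp h.measurable (rootEstimator y)]
  ext i
  simp [rootEstimator, exactSignal, ← h.sum_mul_root hq]

theorem variance_eq_integral_sq (hq : ∀ i, 0 < q i) (h : G.IsDiagRSF q P Φ) (y : V → ℝ)
    (i : V) : variance (fun ω => rootEstimator y (Φ ω) i) P =
      ∫ ω, (rootEstimator y (Φ ω) i - exactSignal (G.diagSmoother q) y i) ^ 2 ∂P := by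
  rw [variance_eq_integral (RootedSpanningForest.memLp_comp h.measurable
    (fun φ => rootEstimator y φ i) 2).aestronglyMeasurable.aemeasurable]
  simp only [rootEstimator, exactSignal, h.integral_root hq]

theorem variance_rootEstimator (hq : ∀ i, 0 < q i) (h : G.IsDiagRSF q P Φ) (y : V → ℝ)
    (i : V) : variance (fun ω => rootEstimator y (Φ ω) i) P =
      (G.diagSmoother q).mulVec (fun k => y k ^ 2) i - (G.diagSmoother q).mulVec y i ^ 2 := by
  rw [variance_eq_sub (RootedSpanningForest.memLp_comp h.measurable
    (fun φ => rootEstimator y φ i) 2), ← h.integral_root hq, ← h.integral_root hq]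
  simp [rootEstimator]

theorem integral_weighted_sq (hq : ∀ i, 0 < q i) (h : G.IsDiagRSF q P Φ) (y a : V → ℝ) :
    ∫ ω, ∑ i, a i * (rootEstimator y (Φ ω) i - exactSignal (G.diagSmoother q) y i) ^ 2 ∂P =
      ∑ i, a i * variance (fun ω => rootEstimator y (Φ ω) i) P := by
  rw [integral_finsetSum _ fun i _ => memLp_one_iff_integrable.1
    (RootedSpanningForest.memLp_comp h.measurable (fun φ => a i *
      (rootEstimator y φ i - exactSignal (G.diagSmoother q) y i) ^ 2) 1)]
  simp only [integral_const_mul, h.variance_eq_integral_sq hq]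

theorem integral_norm_sq (hq : ∀ i, 0 < q i) (h : G.IsDiagRSF q P Φ) (y : V → ℝ) :
    ∫ ω, ‖rootEstimator y (Φ ω) - exactSignal (G.diagSmoother q) y‖ ^ 2 ∂P =
      ∑ i, variance (fun ω => rootEstimator y (Φ ω) i) P := by
  have := h.integral_weighted_sq hq y 1
  simpa [EuclideanSpace.real_norm_sq_eq] using this

theorem sum_variance (hq : ∀ i, 0 < q i) (h : G.IsDiagRSF q P Φ) (y : V → ℝ) :
    ∑ i, variance (fun ω => rootEstimator y (Φ ω) i) P =
      1 ⬝ᵥ (G.diagSmoother q).mulVec (fun k => y k ^ 2) -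
        y ⬝ᵥ ((G.diagSmoother q).transpose * G.diagSmoother q).mulVec y := by
  rw [← Matrix.mulVec_mulVec, Matrix.dotProduct_mulVec y, Matrix.vecMul_transpose, one_dotProduct]
  simp only [h.variance_rootEstimator hq, Finset.sum_sub_distrib, dotProduct, sq]

/-- Symmetry of Q K and K 1 = 1 give 1ᵗ Q K = 1ᵗ Q, so the second moments sum to yᵗ Q y. Symmetry
also turns the squared means Kᵗ Q K into Q K². -/
theorem sum_weighted_variance (hq : ∀ i, 0 < q i) (h : G.IsDiagRSF q P Φ) (y : V → ℝ) :
    ∑ i, q i * variance (fun ω => rootEstimator y (Φ ω) i) P =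
      y ⬝ᵥ (Matrix.diagonal q * (1 - G.diagSmoother q ^ 2)).mulVec y := by
  set K := G.diagSmoother q with hK
  have hsymm : K.transpose * Matrix.diagonal q = Matrix.diagonal q * K := by
    simpa [Matrix.transpose_mul] using G.transpose_diagonal_mul_diagSmoother q
  have hcol (z : V → ℝ) : q ⬝ᵥ K.mulVec z = q ⬝ᵥ z := by
    have hq1 : q = (Matrix.diagonal q).mulVec 1 := by ext i; simp [Matrix.mulVec_diagonal]
    rw [Matrix.dotProduct_mulVec, ← Matrix.mulVec_transpose]
    conv_lhs => rw [hq1]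
    rw [Matrix.mulVec_mulVec, hsymm, ← Matrix.mulVec_mulVec, h.mulVec_one hq, ← hq1]
  have hsq : ∑ i, q i * K.mulVec y i ^ 2 = y ⬝ᵥ (Matrix.diagonal q * K ^ 2).mulVec y := by
    rw [sq, ← Matrix.mul_assoc, ← hsymm, Matrix.mul_assoc, ← Matrix.mulVec_mulVec,
      Matrix.dotProduct_mulVec, Matrix.vecMul_transpose, ← Matrix.mulVec_mulVec]
    simp only [dotProduct, Matrix.mulVec_diagonal]
    exact Finset.sum_congr rfl fun i _ => by ring
  have hdiag : q ⬝ᵥ (fun k => y k ^ 2) = y ⬝ᵥ (Matrix.diagonal q).mulVec y := by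
    simp only [dotProduct, Matrix.mulVec_diagonal]
    exact Finset.sum_congr rfl fun i _ => by ring
  rw [Matrix.mul_sub, Matrix.mul_one, Matrix.sub_mulVec, dotProduct_sub, ← hsq, ← hdiag,
    ← hcol]
  simp only [h.variance_rootEstimator hq, mul_sub, Finset.sum_sub_distrib]
  rfl

end IsDiagRSF

end WeightedGraph

theorem proposition1 {V Ω : Type*} [Fintype V] [DecidableEq V] [MeasurableSpace Ω]
    (G : WeightedGraph V) (y : V → ℝ)
    (P : Measure Ω) [IsProbabilityMeasure P]
    (Φ : Ω → RootedSpanningForest G.toSimpleGraph) :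
    -- the case of a scalar parameter `q`, with `K = q (q I + L)⁻¹`
    (∀ q : ℝ, 0 < q → G.IsRSF q P Φ →
      IsUnit (q • (1 : Matrix V V ℝ) + G.laplacian) ∧
      ∫ ω, rootEstimator y (Φ ω) ∂P = exactSignal (G.smoother q) y ∧
      ∫ ω, ‖rootEstimator y (Φ ω) - exactSignal (G.smoother q) y‖ ^ 2 ∂P
        = ∑ i, variance (fun ω => rootEstimator y (Φ ω) i) P ∧
      ∑ i, variance (fun ω => rootEstimator y (Φ ω) i) P
        = y ⬝ᵥ (1 - G.smoother q ^ 2).mulVec y) ∧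
    -- the case of a positive diagonal matrix `Q = diag q`, with `K = (Q + L)⁻¹ Q`
    (∀ q : V → ℝ, (∀ i, 0 < q i) → G.IsDiagRSF q P Φ →
      IsUnit (Matrix.diagonal q + G.laplacian) ∧
      ∫ ω, rootEstimator y (Φ ω) ∂P = exactSignal (G.diagSmoother q) y ∧
      -- total variance in the Euclidean norm
      ∫ ω, ‖rootEstimator y (Φ ω) - exactSignal (G.diagSmoother q) y‖ ^ 2 ∂P
        = ∑ i, variance (fun ω => rootEstimator y (Φ ω) i) P ∧
      ∑ i, variance (fun ω => rootEstimator y (Φ ω) i) P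
        = 1 ⬝ᵥ (G.diagSmoother q).mulVec (fun k => y k ^ 2)
          - y ⬝ᵥ ((G.diagSmoother q).transpose * G.diagSmoother q).mulVec y ∧
      -- total variance in the norm weighted by `Q`
      ∫ ω, ∑ i, q i * (rootEstimator y (Φ ω) i - exactSignal (G.diagSmoother q) y i) ^ 2 ∂P
        = ∑ i, q i * variance (fun ω => rootEstimator y (Φ ω) i) P ∧
      ∑ i, q i * variance (fun ω => rootEstimator y (Φ ω) i) P
        = y ⬝ᵥ (Matrix.diagonal q * (1 - G.diagSmoother q ^ 2)).mulVec y) := by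
  refine ⟨fun q hq h => ?_, fun q hq h => ⟨G.isUnit_diagonal_add_laplacian hq,
    h.integral_rootEstimator hq y, h.integral_norm_sq hq y, h.sum_variance hq y,
    h.integral_weighted_sq hq y q, h.sum_weighted_variance hq y⟩⟩
  have hq' : ∀ _ : V, 0 < q := fun _ => hq
  have h' := h.isDiagRSF
  have hK := G.diagSmoother_const q
  refine ⟨?_, hK ▸ h'.integral_rootEstimator hq' y, hK ▸ h'.integral_norm_sq hq' y, ?_⟩
  · rw [Matrix.smul_one_eq_diagonal]
    exact G.isUnit_diagonal_add_laplacian hq'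
  -- With Q = q I both sides of the weighted identity carry the factor q, which is nonzero.
  · have hw := h'.sum_weighted_variance hq' y
    rw [hK, ← Matrix.smul_one_eq_diagonal, Matrix.smul_mul, one_mul, Matrix.smul_mulVec,
      dotProduct_smul, smul_eq_mul, ← Finset.mul_sum] at hw
    exact mul_left_cancel₀ hq.ne' hw
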